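/- Let $d\ge 1$ and $n\ge 1$ be integers, let $S^{d-1}=\{x\in\mathbb R^d:\|x\|_2=1\}$, and write $\log$ for the logarithm to base $2$. For $a\in S^{d-1}$ let $g_a:S^{d-1}\to\{0,1\}$ be the homogeneous halfspace $g_a(x)=\operatorname{sign}(a^Tx)$, where the sign $+1$ is identified with the label $1$, the sign $-1$ with the label $0$, and $\operatorname{sign}(0)=+1$. A hypothesis is $f=(g_a,\theta_0,\theta_1)$ with $a\in S^{d-1}$ and $\theta_0,\theta_1\in[0,1]$; under $f$, $Y\mid\{X=x\}\sim\mathrm{Bernoulli}(\theta_{g_a(x)})$, with conditional pmf $p_f(y|x)$, $y\in\{0,1\}$, and $p_f(y^m|x^m)=\prod_{i=1}^m p_f(y_i|x_i)$. Let $P_X$ be the uniform distribution on $S^{d-1}$, and let $(X_i,Y_i)_{i=1}^n$ be i.i.d. with $X_i\sim P_X$ and $Y_i|X_i\sim p_f(\cdot|X_i)$. For a probability assignment $q$ define the regret $$R_{n,P_X}(q,f)=\mathbb E\Big[\sum_{i=1}^n\log\frac1{q(Y_i|X^i,Y^{i-1})}-\sum_{i=1}^n\log\frac1{p_f(Y_i|X_i)}\Big].$$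 Let $F=(g_A,\Theta_0,\Theta_1)$, where $A,\Theta_0,\Theta_1$ are independent, $A$ is uniform on $S^{d-1}$ and $\Theta_0,\Theta_1\sim\mathrm{Beta}(1/2,1/2)$, and let $$q_{\mathrm{mix}}(y_i|x^i,y^{i-1})=\frac{\mathbb E_F[p_F(y^i|x^i)]}{\mathbb E_F[p_F(y^{i-1}|x^{i-1})]}.$$ Then $q_{\mathrm{mix}}(y_i|x^i,y^{i-1})>0$ for all $i\ge 1$, $x^i\in(S^{d-1})^i$ and $y^i\in\{0,1\}^i$, and for every hypothesis $f=(g_a,\theta_0,\theta_1)$ the random variable inside the expectation is integrable and $$R_{n,P_X}(q_{\mathrm{mix}},f)\le(2d+1)\log n+d\log(48d)+\log\frac{\pi^2}{8}.$$ -/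

import Mathlib

open MeasureTheory ProbabilityTheory

noncomputable section

/-- The conditional pmf `p_f(y | x)` of the hypothesis `f = (g, θ₀, θ₁)`: given `X = x`, the label
`Y ∈ {0, 1}` is `Bernoulli(θ_{g(x)})`. -/
def condPmf {S : Type*} (g : S → Fin 2) (θ₀ θ₁ : ℝ) (x : S) (y : Fin 2) : ℝ :=
  let p : ℝ := if g x = 0 then θ₀ else θ₁
  if y = 1 then p else 1 - p

/-- The joint law of one pair `(X, Y)` with `X ∼ P` and `Y | X = x` having pmf `p x`. -/
def pairLaw {S : Type*} [MeasurableSpace S] (P : Measure S) (p : S → Fin 2 → ℝ) :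
    Measure (S × Fin 2) :=
  (P.prod Measure.count).withDensity fun z => ENNReal.ofReal (p z.1 z.2)

/-- The law of `(X_i, Y_i)`, `i = 1, …, n`, drawn i.i.d. from `pairLaw P p`. -/
def sampleLaw {S : Type*} [MeasurableSpace S] (P : Measure S) (p : S → Fin 2 → ℝ) (n : ℕ) :
    Measure (Fin n → S × Fin 2) :=
  Measure.pi fun _ => pairLaw P p

/-- A sequential probability assignment: `q i x y b` is the probability given to `b` as the value
of the label number `i + 1`, when the side information `x` (of length `i + 1`) and the labels
`y` (of length `i`) have been revealed. -/
abbrev ProbAssignment (S : Type*) : Type _ :=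
  (i : ℕ) → (Fin (i + 1) → S) → (Fin i → Fin 2) → Fin 2 → ℝ

/-- The cumulative log-loss (base 2) of `q` minus that of `p` on the sample `z`. -/
def excessLoss {S : Type*} (q : ProbAssignment S) (p : S → Fin 2 → ℝ) (n : ℕ)
    (z : Fin n → S × Fin 2) : ℝ :=
  (∑ i : Fin n, Real.logb 2 (1 / q i
      (fun j => (z (Fin.castLE i.isLt j)).1)
      (fun j => (z (Fin.castLE i.isLt.le j)).2) (z i).2))
    - ∑ i : Fin n, Real.logb 2 (1 / p (z i).1 (z i).2)

/-- The regret `R_{n,P}(q, f)`, where `p` is the conditional pmf of `f`. -/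
def regret {S : Type*} [MeasurableSpace S] (P : Measure S) (q : ProbAssignment S)
    (p : S → Fin 2 → ℝ) (n : ℕ) : ℝ :=
  ∫ z, excessLoss q p n z ∂(sampleLaw P p n)

/-- `𝔼_F[p_F(y^m | x^m)]` for a random hypothesis `F` with parameter distributed as `ρ`. -/
def mixLikelihood {S Φ : Type*} [MeasurableSpace Φ] (ρ : Measure Φ) (p : Φ → S → Fin 2 → ℝ)
    (m : ℕ) (x : Fin m → S) (y : Fin m → Fin 2) : ℝ :=
  ∫ φ, ∏ j, p φ (x j) (y j) ∂ρ

/-- The mixture probability assignment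
`q_mix(y_i | x^i, y^{i-1}) = 𝔼_F[p_F(y^i | x^i)] / 𝔼_F[p_F(y^{i-1} | x^{i-1})]`. -/
def mixAssignment {S Φ : Type*} [MeasurableSpace Φ] (ρ : Measure Φ) (p : Φ → S → Fin 2 → ℝ) :
    ProbAssignment S :=
  fun i x y b =>
    mixLikelihood ρ p (i + 1) x (Fin.snoc (α := fun _ => Fin 2) y b)
      / mixLikelihood ρ p i (fun j => x j.castSucc) y

/-- The unit sphere `S^{d-1}` of `ℝ^d`. -/
abbrev UnitSphere (d : ℕ) : Type :=
  Metric.sphere (0 : EuclideanSpace ℝ (Fin d)) 1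

/-- The uniform distribution on `S^{d-1}`: normalized surface measure. -/
def unifSphere (d : ℕ) : Measure (UnitSphere d) :=
  ((volume : Measure (EuclideanSpace ℝ (Fin d))).toSphere Set.univ)⁻¹ •
    (volume : Measure (EuclideanSpace ℝ (Fin d))).toSphere

/-- The homogeneous halfspace `g_a(x) = sign(aᵀx)`; the sign `+1` is the label `1`, the sign `-1`
is the label `0`, and `sign 0 = +1`. -/
def halfspace {d : ℕ} (a x : UnitSphere d) : Fin 2 :=
  if 0 ≤ inner ℝ (a : EuclideanSpace ℝ (Fin d)) (x : EuclideanSpace ℝ (Fin d)) then 1 else 0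

/-- The law of `(A, Θ₀, Θ₁)`: independent, `A` uniform on the sphere, `Θ₀` and `Θ₁`
both `Beta(1/2, 1/2)`. -/
def halfspacePrior (d : ℕ) : Measure (UnitSphere d × ℝ × ℝ) :=
  (unifSphere d).prod ((betaMeasure (1 / 2) (1 / 2)).prod (betaMeasure (1 / 2) (1 / 2)))

/-- The mixture probability assignment for halfspaces with the prior `halfspacePrior d`. -/
def halfspaceMix (d : ℕ) : ProbAssignment (UnitSphere d) :=
  mixAssignment (halfspacePrior d) fun φ => condPmf (halfspace φ.1) φ.2.1 φ.2.2

end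

/-! The conditional probabilities of the mixture telescope, so the excess loss on a sample is `log
(p_f(y^n|x^n) / E_F p_F(y^n|x^n))`, and it suffices to bound the mixture likelihood from below.

If `r ≤ |⟨a, x_i⟩|` for all `i`, every `a'` within distance `r` of `a` labels the sample exactly as
`a` does. Restricting the prior to this cap, of mass at least `(r/3)^d` (`unifSphere_cap_ge`),
leaves two independent Beta(1/2, 1/2) integrals. These are Krichevsky–Trofimov probabilities, which
lose to the best Bernoulli parameters a joint factor of at most `2n + 1`. Hence `p_f(y^n|x^n)
(r/3)^d ≤ (2n + 1) E_F p_F(y^n|x^n)` (`likelihood_mul_le_halfspaceLikelihood`).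

The margin is controlled by `S = ∑ |⟨a, x_i⟩|^(-1/2)`: since `S` dominates each summand, `r = S⁻²`
is admissible, and the cap costs `2d log S + d log 3`. The exponent `-1/2` keeps the expectation
finite: `E|⟨a, X⟩|^(-1/2) ≤ √(16d/3)` (`lintegral_unifSphere_inner_rpow_le`). By concavity of the
logarithm `E log S ≤ log (n √(16d/3))`, and collecting constants gives the claim. -/

/-! ### Krichevsky–Trofimov estimates. -/

/-- The product `(1/2) (3/2) ⋯ (k - 1/2)`. -/
noncomputable def halfRising (k : ℕ) : ℝ := ∏ i ∈ Finset.range k, ((i : ℝ) + 1 / 2)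

lemma halfRising_pos (k : ℕ) : 0 < halfRising k :=
  Finset.prod_pos fun i _ => by positivity

lemma halfRising_succ (k : ℕ) : halfRising (k + 1) = halfRising k * ((k : ℝ) + 1 / 2) :=
  Finset.prod_range_succ _ _

lemma Gamma_nat_add_half' (k : ℕ) :
    Real.Gamma ((k : ℝ) + 1 / 2) = halfRising k * Real.Gamma (1 / 2) := by
  induction k with
  | zero => simp [halfRising]
  | succ k ih =>
    rw [halfRising_succ, show ((k + 1 : ℕ) : ℝ) + 1 / 2 = ((k : ℝ) + 1 / 2) + 1 by push_cast; ring,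
      Real.Gamma_add_one (by positivity), ih]
    ring

lemma exp_mul_log_natCast (k : ℕ) : Real.exp ((k : ℝ) * Real.log k) = (k : ℝ) ^ k := by
  rcases Nat.eq_zero_or_pos k with rfl | hk
  · simp
  · rw [mul_comm, ← Real.rpow_def_of_pos (by exact_mod_cast hk), Real.rpow_natCast]

/-- At `x = k` this is the log of the ratio of consecutive terms of `k^k / halfRising k`; its
monotonicity makes that sequence supermultiplicative. -/
lemma monotoneOn_add_one_mul_log_sub :
    MonotoneOn (fun x : ℝ => (x + 1) * Real.log (x + 1) - x * Real.log x - Real.log (x + 1 / 2))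
      (Set.Ici 0) := by
  have hderiv : ∀ x : ℝ, 0 < x → HasDerivAt
      (fun x : ℝ => (x + 1) * Real.log (x + 1) - x * Real.log x - Real.log (x + 1 / 2))
      (Real.log (x + 1) - Real.log x - 1 / (x + 1 / 2)) x := by
    intro x hx
    have h1 := (Real.hasDerivAt_mul_log (x := x + 1) (by positivity)).comp_add_const x 1
    have h2 := Real.hasDerivAt_mul_log (x := x) hx.ne'
    have h3 := ((hasDerivAt_id x).add_const (1 / 2 : ℝ)).log (by simp; positivity)
    refine ((h1.sub h2).sub h3).congr_deriv ?_
    simp only [id]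
    ring
  refine monotoneOn_of_deriv_nonneg (convex_Ici 0) ?_ ?_ ?_
  · refine ContinuousOn.sub (ContinuousOn.sub ?_ Real.continuous_mul_log.continuousOn) ?_
    · exact (Real.continuous_mul_log.comp (continuous_id.add continuous_const)).continuousOn
    · refine ContinuousOn.log (by fun_prop) fun x hx => ?_
      have : (0 : ℝ) ≤ x := hx
      positivity
  · intro x hx
    rw [interior_Ici] at hx
    exact (hderiv x hx).differentiableAt.differentiableWithinAt
  · intro x hx
    rw [interior_Ici] at hx
    have hx' : 0 < x := hx
    rw [(hderiv x hx).deriv]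
    -- The inequality `log (1 + u) ≥ 2u / (u + 2)` at `u = 1/x` is exactly nonnegativity of the
    -- derivative.
    have h := Real.le_log_one_add_of_nonneg (x := 1 / x) (by positivity)
    rw [show 1 + 1 / x = (x + 1) / x by field_simp, Real.log_div (by positivity) hx'.ne'] at h
    have : 2 * (1 / x) / (1 / x + 2) = 1 / (x + 1 / 2) := by field_simp; ring
    linarith

lemma pow_self_div_halfRising_succ (k : ℕ) :
    ((k + 1 : ℕ) : ℝ) ^ (k + 1) / halfRising (k + 1) =
      Real.exp (((k : ℝ) + 1) * Real.log (k + 1) - k * Real.log k - Real.log (k + 1 / 2)) *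
        ((k : ℝ) ^ k / halfRising k) := by
  have h1 := exp_mul_log_natCast (k + 1)
  have h2 := exp_mul_log_natCast k
  have h3 := (halfRising_pos k).ne'
  push_cast at h1 ⊢
  rw [Real.exp_sub, Real.exp_sub, h1, h2, Real.exp_log (by positivity), halfRising_succ]
  have : (k : ℝ) ^ k ≠ 0 := by rw [← h2]; positivity
  field_simp

/-- Raising `k` by one multiplies the left side by the growth ratio at `k` and the right side by the
larger ratio at `k + j`. -/
lemma pow_self_div_halfRising_mul_le (k j : ℕ) :
    (k : ℝ) ^ k / halfRising k * ((j : ℝ) ^ j / halfRising j) ≤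
      ((k + j : ℕ) : ℝ) ^ (k + j) / halfRising (k + j) := by
  induction k with
  | zero => simp [halfRising]
  | succ k ih =>
    rw [show k + 1 + j = (k + j) + 1 by ring, pow_self_div_halfRising_succ,
      pow_self_div_halfRising_succ, mul_assoc]
    refine mul_le_mul (Real.exp_le_exp.2 ?_) ih ?_ (Real.exp_pos _).le
    · exact monotoneOn_add_one_mul_log_sub (by simp) (by simp; positivity) (by simp)
    · have := halfRising_pos k
      have := halfRising_pos j
      positivity

lemma mul_pow_le_pow_mul_exp (k : ℕ) {x : ℝ} (hx : 0 ≤ x) :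
    x ^ k ≤ (k : ℝ) ^ k * Real.exp (x - k) := by
  rcases Nat.eq_zero_or_pos k with rfl | hk
  · simpa using hx
  · have hk' : (0 : ℝ) < k := by exact_mod_cast hk
    have h1 : x / k ≤ Real.exp (x / k - 1) := by
      have := Real.add_one_le_exp (x / k - 1)
      linarith
    have h2 := pow_le_pow_left₀ (by positivity) h1 k
    rw [← Real.exp_nat_mul, div_pow, div_le_iff₀ (by positivity)] at h2
    calc x ^ k ≤ _ := h2
      _ = _ := by rw [mul_comm]; congr 2; field_simp

/-- The likelihood is at most its value at the empirical frequency. With `m = k + j`, the bound `x^k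
≤ k^k e^(x-k)` is used at `x = m t` and its analogue at `m (1 - t)`; the exponents cancel. -/
lemma bernoulli_likelihood_le {t : ℝ} (h0 : 0 ≤ t) (h1 : t ≤ 1) (k j : ℕ) :
    t ^ k * (1 - t) ^ j * ((k + j : ℕ) : ℝ) ^ (k + j) ≤ (k : ℝ) ^ k * (j : ℝ) ^ j := by
  have a := mul_pow_le_pow_mul_exp k (x := ((k + j : ℕ) : ℝ) * t) (by positivity)
  have b := mul_pow_le_pow_mul_exp j (x := ((k + j : ℕ) : ℝ) * (1 - t))
    (mul_nonneg (by positivity) (by linarith))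
  have c := mul_le_mul a b (pow_nonneg (mul_nonneg (by positivity) (by linarith)) _)
    (by positivity)
  have e : Real.exp (((k + j : ℕ) : ℝ) * t - k) * Real.exp (((k + j : ℕ) : ℝ) * (1 - t) - j) = 1 := by
    rw [← Real.exp_add, Real.exp_eq_one_iff]
    push_cast
    ring
  calc _ = (((k + j : ℕ) : ℝ) * t) ^ k * (((k + j : ℕ) : ℝ) * (1 - t)) ^ j := by
        rw [mul_pow, mul_pow, pow_add]; ring
    _ ≤ _ := c
    _ = (k : ℝ) ^ k * (j : ℝ) ^ j * (Real.exp (((k + j : ℕ) : ℝ) * t - k) *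
          Real.exp (((k + j : ℕ) : ℝ) * (1 - t) - j)) := by ring
    _ = _ := by rw [e, mul_one]

/-- The Krichevsky–Trofimov probability of a word with `k` ones and `j` zeros. -/
noncomputable def ktProb (k j : ℕ) : ℝ := halfRising k * halfRising j / (k + j).factorial

lemma ktProb_pos (k j : ℕ) : 0 < ktProb k j := by
  have := halfRising_pos k
  have := halfRising_pos j
  unfold ktProb
  positivity

/-- The factor `m! / halfRising m` is attained by constant words: supermultiplicativity of `k^k /
halfRising k` says that they are the worst case. -/
lemma bernoulli_likelihood_le_ktProb {t : ℝ} (h0 : 0 ≤ t) (h1 : t ≤ 1) (k j : ℕ) :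
    t ^ k * (1 - t) ^ j ≤ ktProb k j * ((k + j).factorial / halfRising (k + j)) := by
  have hk := halfRising_pos k
  have hj := halfRising_pos j
  have hm := halfRising_pos (k + j)
  have hu : (0 : ℝ) < ((k + j : ℕ) : ℝ) ^ (k + j) := by
    rw [← exp_mul_log_natCast]; positivity
  have a := bernoulli_likelihood_le h0 h1 k j
  have b := pow_self_div_halfRising_mul_le k j
  rw [div_mul_div_comm, div_le_div_iff₀ (by positivity) hm] at b
  have e : ktProb k j * ((k + j).factorial / halfRising (k + j)) =
      halfRising k * halfRising j / halfRising (k + j) := by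
    unfold ktProb; field_simp
  rw [e, le_div_iff₀ hm]
  refine le_of_mul_le_mul_right ?_ hu
  nlinarith [mul_le_mul_of_nonneg_right a hm.le]

/-- The induction step is `(4m + 1)(m + 1)² ≤ (4m + 5)(m + 1/2)²`, whose two sides differ by `1/4`.
-/
lemma sq_factorial_div_halfRising_le (m : ℕ) :
    ((m.factorial : ℝ) / halfRising m) ^ 2 ≤ 4 * m + 1 := by
  induction m with
  | zero => simp [halfRising]
  | succ m ih =>
    have hm := halfRising_pos m
    have e : (((m + 1).factorial : ℝ) / halfRising (m + 1)) ^ 2 =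
        ((m.factorial : ℝ) / halfRising m) ^ 2 * (((m : ℝ) + 1) / (m + 1 / 2)) ^ 2 := by
      rw [Nat.factorial_succ, halfRising_succ]; push_cast; field_simp
    rw [e]
    refine (mul_le_mul_of_nonneg_right ih (by positivity)).trans ?_
    rw [div_pow, mul_div_assoc', div_le_iff₀ (by positivity)]
    push_cast
    nlinarith

/-- AM–GM for `4k + 1` and `4j + 1`: one factor linear in the sample size pays for both unknown
parameters. -/
lemma factorial_div_halfRising_mul_le (k j : ℕ) :
    (k.factorial : ℝ) / halfRising k * (j.factorial / halfRising j) ≤ 2 * ((k : ℝ) + j) + 1 := by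
  have hk := halfRising_pos k
  have hj := halfRising_pos j
  refine le_of_sq_le_sq ?_ (by positivity)
  rw [mul_pow]
  refine (mul_le_mul (sq_factorial_div_halfRising_le k) (sq_factorial_div_halfRising_le j)
    (by positivity) (by positivity)).trans ?_
  nlinarith [sq_nonneg ((k : ℝ) - j)]

lemma beta_nat_add_half (k j : ℕ) :
    beta ((k : ℝ) + 1 / 2) ((j : ℝ) + 1 / 2) = ktProb k j * beta (1 / 2) (1 / 2) := by
  unfold beta ktProb
  rw [Gamma_nat_add_half', Gamma_nat_add_half',
    show (k : ℝ) + 1 / 2 + (j + 1 / 2) = ((k + j : ℕ) : ℝ) + 1 by push_cast; ring,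
    Real.Gamma_nat_eq_factorial, show (1 / 2 + 1 / 2 : ℝ) = 1 by norm_num, Real.Gamma_one]
  ring

lemma measurable_betaPDF (α β : ℝ) : Measurable (betaPDF α β) :=
  (measurable_betaPDFReal α β).ennreal_ofReal

lemma lintegral_betaMeasure_half (k j : ℕ) :
    ∫⁻ t, ENNReal.ofReal (t ^ k * (1 - t) ^ j) ∂betaMeasure (1 / 2) (1 / 2) =
      ENNReal.ofReal (ktProb k j) := by
  have hb := beta_pos (α := 1 / 2) (β := 1 / 2) (by norm_num) (by norm_num)
  have hk := ktProb_pos k j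
  rw [betaMeasure, lintegral_withDensity_eq_lintegral_mul _
    (measurable_betaPDF _ _) (by fun_prop)]
  have key : ∀ t : ℝ, (betaPDF (1 / 2) (1 / 2) * fun t : ℝ => ENNReal.ofReal (t ^ k * (1 - t) ^ j)) t
      = ENNReal.ofReal (ktProb k j) * betaPDF ((k : ℝ) + 1 / 2) ((j : ℝ) + 1 / 2) t := by
    intro t
    rw [Pi.mul_apply, betaPDF_eq, betaPDF_eq]
    split_ifs with h
    · obtain ⟨h0, h1⟩ := h
      have h1' : 0 < 1 - t := by linarith
      rw [← ENNReal.ofReal_mul (by positivity), ← ENNReal.ofReal_mul hk.le, beta_nat_add_half,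
        show (k : ℝ) + 1 / 2 - 1 = k + (1 / 2 - 1) by ring,
        show (j : ℝ) + 1 / 2 - 1 = j + (1 / 2 - 1) by ring, Real.rpow_add h0, Real.rpow_add h1',
        Real.rpow_natCast, Real.rpow_natCast]
      congr 1
      field_simp
    · simp
  simp_rw [key]
  rw [lintegral_const_mul _ (measurable_betaPDF _ _),
    lintegral_betaPDF_eq_one (by positivity) (by positivity), mul_one]

lemma ae_betaMeasure_mem_Ioo (α β : ℝ) : ∀ᵐ t ∂betaMeasure α β, t ∈ Set.Ioo (0 : ℝ) 1 := by
  rw [betaMeasure, ae_withDensity_iff (measurable_betaPDF _ _)]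
  refine Filter.Eventually.of_forall fun t ht => ?_
  by_contra h
  exact ht (by rw [betaPDF_eq, if_neg (by simpa using h), ENNReal.ofReal_zero])

/-! ### Uniform measure on the sphere and the mass of caps. -/

lemma volume_unitBall_ne_zero_ne_top (d : ℕ) :
    (volume : Measure (EuclideanSpace ℝ (Fin d))) (Metric.ball 0 1) ≠ 0 ∧
    (volume : Measure (EuclideanSpace ℝ (Fin d))) (Metric.ball 0 1) ≠ ⊤ :=
  ⟨(Metric.measure_ball_pos _ _ one_pos).ne', measure_ball_lt_top.ne⟩

/-- The radial projection onto the unit sphere, with the value `a` at the origin. -/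
noncomputable def radialProj {d : ℕ} (a : UnitSphere d) (y : EuclideanSpace ℝ (Fin d)) :
    UnitSphere d :=
  ⟨if y = 0 then (a : EuclideanSpace ℝ (Fin d)) else ‖y‖⁻¹ • y, by
    split_ifs with h
    · exact a.2
    · have : ‖y‖ ≠ 0 := norm_ne_zero_iff.2 h
      simp [norm_smul, this]⟩

lemma radialProj_of_ne {d : ℕ} (a : UnitSphere d) {y : EuclideanSpace ℝ (Fin d)} (h : y ≠ 0) :
    (radialProj a y : EuclideanSpace ℝ (Fin d)) = ‖y‖⁻¹ • y := by
  simp [radialProj, h]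

lemma measurable_radialProj {d : ℕ} (a : UnitSphere d) : Measurable (radialProj a) :=
  (Measurable.ite (measurableSet_singleton _) measurable_const
    (measurable_norm.inv.smul measurable_id)).subtype_mk

open scoped Pointwise in
lemma Ioo_smul_image_sphere {d : ℕ} (a : UnitSphere d) (s : Set (UnitSphere d)) :
    Set.Ioo (0 : ℝ) 1 • ((↑) '' s : Set (EuclideanSpace ℝ (Fin d))) =
      (radialProj a ⁻¹' s ∩ Metric.ball 0 1) \ {0} := by
  ext y
  simp only [Set.mem_smul, Set.mem_image, Set.mem_sdiff, Set.mem_inter_iff, Set.mem_preimage,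
    Metric.mem_ball, dist_zero_right, Set.mem_singleton_iff]
  constructor
  · rintro ⟨r, ⟨hr0, hr1⟩, _, ⟨x, hx, rfl⟩, rfl⟩
    have hxn : ‖(x : EuclideanSpace ℝ (Fin d))‖ = 1 := by simp
    have hn : ‖r • (x : EuclideanSpace ℝ (Fin d))‖ = r := by
      rw [norm_smul, hxn, Real.norm_of_nonneg hr0.le, mul_one]
    have h0 : r • (x : EuclideanSpace ℝ (Fin d)) ≠ 0 := by
      rw [← norm_ne_zero_iff, hn]; exact hr0.ne'
    refine ⟨⟨?_, by rw [hn]; exact hr1⟩, h0⟩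
    have : radialProj a (r • (x : EuclideanSpace ℝ (Fin d))) = x := by
      apply Subtype.ext
      rw [radialProj_of_ne a h0, hn, smul_smul, inv_mul_cancel₀ hr0.ne', one_smul]
    rwa [this]
  · rintro ⟨⟨hs, hb⟩, h0⟩
    have hn : 0 < ‖y‖ := norm_pos_iff.2 h0
    refine ⟨‖y‖, ⟨hn, hb⟩, _, ⟨_, hs, rfl⟩, ?_⟩
    rw [radialProj_of_ne a h0, smul_smul, mul_inv_cancel₀ hn.ne', one_smul]

/-- A uniform point of the sphere is the direction of a uniform point of the ball, so sphere
estimates become Lebesgue estimates. -/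
lemma unifSphere_eq_map_radialProj {d : ℕ} (hd : 1 ≤ d) (a : UnitSphere d) :
    unifSphere d = ((volume : Measure (EuclideanSpace ℝ (Fin d))) (Metric.ball 0 1))⁻¹ •
      ((volume.restrict (Metric.ball 0 1)).map (radialProj a)) := by
  have : Nonempty (Fin d) := ⟨⟨0, hd⟩⟩
  ext s hs
  rw [unifSphere, Measure.smul_apply, Measure.smul_apply, Measure.map_apply
    (measurable_radialProj a) hs, Measure.restrict_apply (measurable_radialProj a hs),
    Measure.toSphere_apply_univ, Measure.toSphere_apply' _ hs, Ioo_smul_image_sphere a,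
    measure_sdiff_null (measure_singleton _), finrank_euclideanSpace_fin, smul_eq_mul, smul_eq_mul]
  have hd0 : (d : ENNReal) ≠ 0 := by simp; omega
  rw [ENNReal.mul_inv (Or.inl hd0) (Or.inl (by simp)), mul_mul_mul_comm, mul_comm _ (d : ENNReal),
    mul_comm (d : ENNReal), ENNReal.inv_mul_cancel hd0 (by simp), one_mul]

lemma isProbabilityMeasure_unifSphere {d : ℕ} (hd : 1 ≤ d) :
    IsProbabilityMeasure (unifSphere d) := by
  have : Nonempty (Fin d) := ⟨⟨0, hd⟩⟩
  refine ⟨?_⟩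
  rw [unifSphere, Measure.smul_apply, smul_eq_mul, ENNReal.inv_mul_cancel]
  · rw [Measure.measure_univ_ne_zero]
    exact Measure.toSphere_ne_zero _
  · exact measure_ne_top _ _

lemma radialProj_near {d : ℕ} (a : UnitSphere d) {r : ℝ} (hr0 : 0 < r) (hr1 : r ≤ 1)
    {y : EuclideanSpace ℝ (Fin d)}
    (hy : y ∈ Metric.ball ((1 - r / 3) • (a : EuclideanSpace ℝ (Fin d))) (r / 3)) :
    y ∈ Metric.ball 0 1 ∧ ‖(radialProj a y : EuclideanSpace ℝ (Fin d)) - a‖ < r := by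
  have han : ‖(a : EuclideanSpace ℝ (Fin d))‖ = 1 := by simp
  have hsn : ‖(1 - r / 3) • (a : EuclideanSpace ℝ (Fin d))‖ = 1 - r / 3 := by
    rw [norm_smul, han, mul_one, Real.norm_of_nonneg (by linarith)]
  rw [mem_ball_iff_norm] at hy
  have h1 := norm_sub_norm_le y ((1 - r / 3) • (a : EuclideanSpace ℝ (Fin d)))
  have h2 := norm_sub_norm_le ((1 - r / 3) • (a : EuclideanSpace ℝ (Fin d))) y
  rw [norm_sub_rev _ y] at h2
  rw [hsn] at h1 h2
  have hyp : 0 < ‖y‖ := by linarith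
  refine ⟨by rw [mem_ball_zero_iff]; linarith, ?_⟩
  rw [radialProj_of_ne a (norm_pos_iff.1 hyp)]
  have hs : 0 < 1 - r / 3 := by linarith
  have e : ‖y‖⁻¹ • y - (a : EuclideanSpace ℝ (Fin d)) =
      (1 - r / 3)⁻¹ • ((y - (1 - r / 3) • (a : EuclideanSpace ℝ (Fin d))) +
        ((1 - r / 3) - ‖y‖) • (‖y‖⁻¹ • y)) := by
    rw [sub_smul (1 - r / 3) ‖y‖, smul_smul ‖y‖, mul_inv_cancel₀ hyp.ne', one_smul, smul_add, smul_sub, smul_sub,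
      smul_smul, smul_smul, inv_mul_cancel₀ hs.ne', one_smul, one_smul]
    abel
  have h3 : |1 - r / 3 - ‖y‖| ≤ ‖y - (1 - r / 3) • (a : EuclideanSpace ℝ (Fin d))‖ := by
    rw [abs_le]; constructor <;> linarith
  rw [e, norm_smul, norm_inv, Real.norm_of_nonneg hs.le, inv_mul_lt_iff₀ hs]
  refine (norm_add_le _ _).trans_lt ?_
  rw [norm_smul, norm_smul, norm_inv, norm_norm, inv_mul_cancel₀ hyp.ne', mul_one,
    Real.norm_eq_abs]
  -- Both terms of the numerator are below `r/3`, and `(2r/3) / (1 - r/3) ≤ r` because `r ≤ 1`.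
  nlinarith

/-- The ball of radius `r/3` about `(1 - r/3) a` lies in the unit ball and projects into the cap;
its share of the volume is `(r/3)^d`. -/
lemma unifSphere_cap_ge {d : ℕ} (hd : 1 ≤ d) (a : UnitSphere d) {r : ℝ} (hr0 : 0 < r)
    (hr1 : r ≤ 1) :
    ENNReal.ofReal ((r / 3) ^ d) ≤
      unifSphere d {x | ‖(x : EuclideanSpace ℝ (Fin d)) - a‖ < r} := by
  obtain ⟨h0, ht⟩ := volume_unitBall_ne_zero_ne_top d
  have hs : MeasurableSet {x : UnitSphere d | ‖(x : EuclideanSpace ℝ (Fin d)) - a‖ < r} :=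
    measurableSet_lt (by fun_prop) measurable_const
  rw [unifSphere_eq_map_radialProj hd a, Measure.smul_apply, Measure.map_apply
    (measurable_radialProj a) hs, Measure.restrict_apply (measurable_radialProj a hs), smul_eq_mul]
  have hsub : Metric.ball ((1 - r / 3) • (a : EuclideanSpace ℝ (Fin d))) (r / 3) ⊆
      radialProj a ⁻¹' {x | ‖(x : EuclideanSpace ℝ (Fin d)) - a‖ < r} ∩ Metric.ball 0 1 :=
    fun y hy => ⟨(radialProj_near a hr0 hr1 hy).2, (radialProj_near a hr0 hr1 hy).1⟩
  have : Nonempty (Fin d) := ⟨⟨0, hd⟩⟩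
  have hv := Measure.addHaar_ball (volume : Measure (EuclideanSpace ℝ (Fin d)))
    ((1 - r / 3) • (a : EuclideanSpace ℝ (Fin d))) (r := r / 3) (by positivity)
  rw [finrank_euclideanSpace_fin] at hv
  calc ENNReal.ofReal ((r / 3) ^ d)
      = (volume (Metric.ball (0 : EuclideanSpace ℝ (Fin d)) 1))⁻¹ *
        (ENNReal.ofReal ((r / 3) ^ d) * volume (Metric.ball (0 : EuclideanSpace ℝ (Fin d)) 1)) := by
        rw [mul_left_comm, ENNReal.inv_mul_cancel h0 ht, mul_one]
    _ ≤ _ := by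
        rw [← hv]
        exact mul_le_mul_right (measure_mono hsub) _

/-! ### The moment of order `-1/2` of `⟨a, X⟩`. -/

/-- Projecting a point of the open unit ball outward increases `|⟨a, y⟩|`, hence decreases its
negative power. -/
lemma lintegral_unifSphere_le {d : ℕ} (hd : 1 ≤ d) (a : UnitSphere d) :
    ∫⁻ x, ENNReal.ofReal |inner ℝ (a : EuclideanSpace ℝ (Fin d)) (x : EuclideanSpace ℝ (Fin d))| ^
        (-(1 / 2) : ℝ) ∂unifSphere d ≤
      (volume (Metric.ball (0 : EuclideanSpace ℝ (Fin d)) 1))⁻¹ *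
        ∫⁻ y in Metric.ball (0 : EuclideanSpace ℝ (Fin d)) 1,
          ENNReal.ofReal |inner ℝ (a : EuclideanSpace ℝ (Fin d)) y| ^ (-(1 / 2) : ℝ) := by
  have : Nonempty (Fin d) := ⟨⟨0, hd⟩⟩
  rw [unifSphere_eq_map_radialProj hd a, lintegral_smul_measure, smul_eq_mul,
    lintegral_map (by fun_prop) (measurable_radialProj a)]
  refine mul_le_mul_right (lintegral_mono_ae ?_) _
  have hne : ∀ᵐ y : EuclideanSpace ℝ (Fin d) ∂volume, y ≠ 0 := by
    simp [ae_iff]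
  filter_upwards [ae_restrict_mem measurableSet_ball, ae_restrict_of_ae hne] with y hy hy0
  rw [mem_ball_zero_iff] at hy
  have hn : 0 < ‖y‖ := norm_pos_iff.2 hy0
  rw [ENNReal.rpow_neg, ENNReal.rpow_neg]
  refine ENNReal.inv_le_inv.2 (ENNReal.rpow_le_rpow (ENNReal.ofReal_le_ofReal ?_) (by norm_num))
  rw [radialProj_of_ne a hy0, inner_smul_right, abs_mul, abs_inv, abs_norm]
  exact le_mul_of_one_le_left (abs_nonneg _) ((one_le_inv₀ hn).2 hy.le)

lemma volume_unitBall_euclidean (m : ℕ) :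
    volume (Metric.ball (0 : EuclideanSpace ℝ (Fin m)) 1) =
      ENNReal.ofReal (√Real.pi ^ m / Real.Gamma ((m : ℝ) / 2 + 1)) := by
  rcases Nat.eq_zero_or_pos m with rfl | hm
  · have h : Metric.ball (0 : EuclideanSpace ℝ (Fin 0)) 1 = Set.univ :=
      Set.eq_univ_of_forall fun x => by simp [Subsingleton.elim x 0]
    rw [h, ← (EuclideanSpace.volume_preserving_symm_measurableEquiv_toLp (Fin 0)).symm.measure_preimage
      MeasurableSet.univ.nullMeasurableSet]
    simp [volume_pi]
  · have : Nonempty (Fin m) := ⟨⟨0, hm⟩⟩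
    rw [EuclideanSpace.volume_ball]
    simp

/-- Log-convexity of `Γ` at the midpoint of `x` and `x + 1`. -/
lemma Gamma_add_half_le {x : ℝ} (hx : 0 < x) :
    Real.Gamma (x + 1 / 2) ≤ Real.Gamma x * √x := by
  have h := Real.Gamma_mul_add_mul_le_rpow_Gamma_mul_rpow_Gamma hx (by linarith : 0 < x + 1)
    (a := 1 / 2) (b := 1 / 2) (by norm_num) (by norm_num) (by norm_num)
  have hG := Real.Gamma_pos_of_pos hx
  rw [Real.Gamma_add_one hx.ne', ← Real.sqrt_eq_rpow, ← Real.sqrt_eq_rpow,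
    Real.sqrt_mul hx.le, show 1 / 2 * x + 1 / 2 * (x + 1) = x + 1 / 2 by ring] at h
  calc _ ≤ _ := h
    _ = (√(Real.Gamma x) * √(Real.Gamma x)) * √x := by ring
    _ = _ := by rw [Real.mul_self_sqrt hG.le]

lemma volume_unitBall_le_mul_succ (m : ℕ) :
    volume (Metric.ball (0 : EuclideanSpace ℝ (Fin m)) 1) ≤
      ENNReal.ofReal (√(((m : ℝ) + 1) / Real.pi)) *
        volume (Metric.ball (0 : EuclideanSpace ℝ (Fin (m + 1))) 1) := by
  rw [volume_unitBall_euclidean, volume_unitBall_euclidean, ← ENNReal.ofReal_mul (by positivity)]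
  apply ENNReal.ofReal_le_ofReal
  have hx : (0 : ℝ) < (m : ℝ) / 2 + 1 := by positivity
  have h := Gamma_add_half_le hx
  have hG := Real.Gamma_pos_of_pos hx
  have hG' := Real.Gamma_pos_of_pos (show (0 : ℝ) < (m : ℝ) / 2 + 1 + 1 / 2 by positivity)
  have hs : √((m : ℝ) / 2 + 1) ≤ √((m : ℝ) + 1) := Real.sqrt_le_sqrt (by
    have : (0 : ℝ) ≤ m := by positivity
    linarith)
  have hpi : 0 < √Real.pi := Real.sqrt_pos.2 Real.pi_pos
  rw [show ((m + 1 : ℕ) : ℝ) / 2 + 1 = (m : ℝ) / 2 + 1 + 1 / 2 by push_cast; ring,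
    Real.sqrt_div' _ Real.pi_pos.le, div_mul_div_comm, div_le_div_iff₀ hG (by positivity), pow_succ]
  have : Real.Gamma ((m : ℝ) / 2 + 1 + 1 / 2) ≤ √((m : ℝ) + 1) * Real.Gamma ((m : ℝ) / 2 + 1) :=
    h.trans (by rw [mul_comm]; gcongr)
  calc √Real.pi ^ m * (√Real.pi * Real.Gamma ((m : ℝ) / 2 + 1 + 1 / 2))
      ≤ √Real.pi ^ m * (√Real.pi * (√((m : ℝ) + 1) * Real.Gamma ((m : ℝ) / 2 + 1))) := by gcongr
    _ = _ := by ring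

lemma lintegral_Ioo_rpow_neg_half :
    ∫⁻ t in Set.Ioo (0 : ℝ) 1, ENNReal.ofReal |t| ^ (-(1 / 2) : ℝ) = 2 := by
  have hint : IntegrableOn (fun t : ℝ => t ^ (-(1 / 2) : ℝ)) (Set.Ioc 0 1) := by
    rw [← intervalIntegrable_iff_integrableOn_Ioc_of_le zero_le_one]
    exact intervalIntegral.intervalIntegrable_rpow' (by norm_num)
  have e : ∫⁻ t in Set.Ioo (0 : ℝ) 1, ENNReal.ofReal |t| ^ (-(1 / 2) : ℝ) =
      ∫⁻ t in Set.Ioc (0 : ℝ) 1, ENNReal.ofReal (t ^ (-(1 / 2) : ℝ)) := by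
    rw [restrict_Ioo_eq_restrict_Ioc]
    refine setLIntegral_congr_fun measurableSet_Ioc fun t ht => ?_
    rw [abs_of_pos ht.1, ENNReal.ofReal_rpow_of_pos ht.1]
  rw [e, ← ofReal_integral_eq_lintegral_ofReal hint, ← intervalIntegral.integral_of_le zero_le_one,
    integral_rpow (Or.inl (by norm_num))]
  · norm_num
  · filter_upwards [ae_restrict_mem measurableSet_Ioc] with t ht
    exact Real.rpow_nonneg ht.1.le _

lemma lintegral_Ioo_abs_rpow_neg_half :
    ∫⁻ t in Set.Ioo (-1 : ℝ) 1, ENNReal.ofReal |t| ^ (-(1 / 2) : ℝ) ≤ 4 := by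
  have h := (Measure.measurePreserving_neg (volume : Measure ℝ)).setLIntegral_comp_preimage
    (s := Set.Ioo 0 1) measurableSet_Ioo
    (f := fun t : ℝ => ENNReal.ofReal |t| ^ (-(1 / 2) : ℝ)) (by fun_prop)
  have hp : Neg.neg ⁻¹' Set.Ioo (0 : ℝ) 1 = Set.Ioo (-1) 0 := by
    ext t
    simp only [Set.mem_preimage, Set.mem_Ioo]
    constructor <;> rintro ⟨_, _⟩ <;> constructor <;> linarith
  rw [hp, lintegral_Ioo_rpow_neg_half] at h
  simp only [abs_neg] at h
  rw [← Set.Ioc_union_Ioo_eq_Ioo (by norm_num : (-1 : ℝ) ≤ 0) (by norm_num : (0 : ℝ) < 1)]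
  refine (lintegral_union_le _ _ _).trans ?_
  rw [lintegral_Ioo_rpow_neg_half, ← restrict_Ioo_eq_restrict_Ioc, h]
  norm_num

lemma exists_orthonormalBasis_zero_eq {m : ℕ} (a : UnitSphere (m + 1)) :
    ∃ b : OrthonormalBasis (Fin (m + 1)) ℝ (EuclideanSpace ℝ (Fin (m + 1))),
      b 0 = (a : EuclideanSpace ℝ (Fin (m + 1))) := by
  have hv : Orthonormal ℝ (({0} : Set (Fin (m + 1))).domRestrict
      fun _ => (a : EuclideanSpace ℝ (Fin (m + 1)))) := by
    refine ⟨fun i => by simp, fun i j hij => ?_⟩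
    exact absurd (Subtype.ext (i.2.trans j.2.symm)) hij
  obtain ⟨b, hb⟩ := hv.exists_orthonormalBasis_extension_of_card_eq (by simp)
  exact ⟨b, hb 0 rfl⟩

/-- The ball sits inside the cylinder `(-1, 1) × B_m`, over which the integral factors; the interval
contributes at most 4. -/
lemma lintegral_unitBall_coord_le {m : ℕ} :
    ∫⁻ z in Metric.ball (0 : EuclideanSpace ℝ (Fin (m + 1))) 1,
        ENNReal.ofReal |z 0| ^ (-(1 / 2) : ℝ) ≤
      4 * volume (Metric.ball (0 : EuclideanSpace ℝ (Fin m)) 1) := by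
  set G : ℝ → ENNReal :=
    (Set.Ioo (-1 : ℝ) 1).indicator fun t => ENNReal.ofReal |t| ^ (-(1 / 2) : ℝ) with hG
  set B : Set (Fin m → ℝ) := WithLp.toLp 2 ⁻¹' Metric.ball (0 : EuclideanSpace ℝ (Fin m)) 1 with hB
  have hBm : MeasurableSet B := (WithLp.measurable_toLp _ _) measurableSet_ball
  have hGm : Measurable G := Measurable.indicator (by fun_prop) measurableSet_Ioo
  have hvB : volume B = volume (Metric.ball (0 : EuclideanSpace ℝ (Fin m)) 1) :=
    (PiLp.volume_preserving_toLp (Fin m)).measure_preimage measurableSet_ball.nullMeasurableSet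
  have hmp := (volume_preserving_piFinSuccAbove (fun _ : Fin (m + 1) => ℝ) 0).comp
    (PiLp.volume_preserving_ofLp (Fin (m + 1)))
  have hF : Measurable fun p : ℝ × (Fin m → ℝ) => G p.1 * B.indicator 1 p.2 :=
    (hGm.comp measurable_fst).mul ((measurable_one.indicator hBm).comp measurable_snd)
  calc ∫⁻ z in Metric.ball (0 : EuclideanSpace ℝ (Fin (m + 1))) 1,
        ENNReal.ofReal |z 0| ^ (-(1 / 2) : ℝ)
      ≤ ∫⁻ z : EuclideanSpace ℝ (Fin (m + 1)), (fun p : ℝ × (Fin m → ℝ) =>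
          G p.1 * B.indicator 1 p.2)
            ((MeasurableEquiv.piFinSuccAbove (fun _ : Fin (m + 1) => ℝ) 0 ∘ WithLp.ofLp) z) := by
        rw [← lintegral_indicator measurableSet_ball]
        refine lintegral_mono (Set.indicator_le fun z hz => ?_)
        have hsum : z 0 ^ 2 + ∑ i : Fin m, z i.succ ^ 2 < 1 := by
          have h1 : ‖z‖ < 1 := mem_ball_zero_iff.1 hz
          rw [← Fin.sum_univ_succ (f := fun i => z i ^ 2), ← EuclideanSpace.real_norm_sq_eq]
          nlinarith [norm_nonneg z]
        have h0 : z 0 ∈ Set.Ioo (-1 : ℝ) 1 := by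
          have : 0 ≤ ∑ i : Fin m, z i.succ ^ 2 := Finset.sum_nonneg fun i _ => sq_nonneg _
          exact abs_lt.1 (by rw [← sq_lt_one_iff_abs_lt_one]; linarith)
        have hB' : (fun i : Fin m => z i.succ) ∈ B := by
          rw [hB, Set.mem_preimage, mem_ball_zero_iff, ← sq_lt_one_iff₀ (norm_nonneg _),
            EuclideanSpace.real_norm_sq_eq]
          have := sq_nonneg (z 0)
          simp only
          linarith
        change _ ≤ G (z 0) * B.indicator 1 (fun i : Fin m => z i.succ)
        rw [hG, Set.indicator_of_mem h0, Set.indicator_of_mem hB']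
        simp
    _ = ∫⁻ p : ℝ × (Fin m → ℝ), G p.1 * B.indicator 1 p.2 := hmp.lintegral_comp hF
    _ = (∫⁻ t, G t) * ∫⁻ w, B.indicator 1 w := by
        rw [Measure.volume_eq_prod, lintegral_prod_mul hGm.aemeasurable
          (measurable_one.indicator hBm).aemeasurable]
    _ ≤ _ := by
        rw [lintegral_indicator_one hBm, hvB, hG, lintegral_indicator measurableSet_Ioo]
        gcongr
        exact lintegral_Ioo_abs_rpow_neg_half

lemma lintegral_unitBall_inner_le {m : ℕ} (a : UnitSphere (m + 1)) :
    ∫⁻ y in Metric.ball (0 : EuclideanSpace ℝ (Fin (m + 1))) 1,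
        ENNReal.ofReal |inner ℝ (a : EuclideanSpace ℝ (Fin (m + 1))) y| ^ (-(1 / 2) : ℝ) ≤
      4 * volume (Metric.ball (0 : EuclideanSpace ℝ (Fin m)) 1) := by
  obtain ⟨b, hb⟩ := exists_orthonormalBasis_zero_eq a
  have h := b.measurePreserving_repr.setLIntegral_comp_preimage
    (s := Metric.ball 0 1) measurableSet_ball
    (f := fun z : EuclideanSpace ℝ (Fin (m + 1)) => ENNReal.ofReal |z 0| ^ (-(1 / 2) : ℝ))
    (by fun_prop)
  rw [LinearIsometryEquiv.preimage_ball, map_zero] at h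
  simp only [OrthonormalBasis.repr_apply_apply, hb] at h
  exact h.le.trans lintegral_unitBall_coord_le

lemma lintegral_unifSphere_inner_rpow_le {d : ℕ} (hd : 1 ≤ d) (a : UnitSphere d) :
    ∫⁻ x, ENNReal.ofReal |inner ℝ (a : EuclideanSpace ℝ (Fin d)) (x : EuclideanSpace ℝ (Fin d))| ^
        (-(1 / 2) : ℝ) ∂unifSphere d ≤ ENNReal.ofReal (√(16 * d / 3)) := by
  obtain ⟨m, rfl⟩ : ∃ m, d = m + 1 := ⟨d - 1, by omega⟩
  obtain ⟨h0, ht⟩ := volume_unitBall_ne_zero_ne_top (m + 1)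
  refine (lintegral_unifSphere_le hd a).trans ?_
  refine (mul_le_mul_right ((lintegral_unitBall_inner_le a).trans
    (mul_le_mul_right (volume_unitBall_le_mul_succ m) _)) _).trans ?_
  rw [← mul_assoc 4, mul_left_comm, ENNReal.inv_mul_cancel h0 ht, mul_one,
    show (4 : ENNReal) = ENNReal.ofReal 4 by norm_num, ← ENNReal.ofReal_mul (by norm_num)]
  apply ENNReal.ofReal_le_ofReal
  rw [show (4 : ℝ) = √16 by rw [show (16 : ℝ) = 4 ^ 2 by norm_num]; simp,
    ← Real.sqrt_mul (by norm_num)]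
  apply Real.sqrt_le_sqrt
  push_cast
  rw [mul_div_assoc]
  gcongr
  -- The value `4 √(d/π)` is relaxed to `√(16d/3)` through `π > 3`.
  exact Real.pi_gt_three.le

/-! ### Telescoping of the mixture's log-loss. -/

lemma sum_logb_one_div_mixAssignment {S Φ : Type*} [MeasurableSpace Φ] (ρ : Measure Φ)
    [IsProbabilityMeasure ρ] (p : Φ → S → Fin 2 → ℝ)
    (hpos : ∀ m x y, 0 < mixLikelihood ρ p m x y) (n : ℕ) (z : Fin n → S × Fin 2) :
    ∑ i : Fin n, Real.logb 2 (1 / mixAssignment ρ p i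
      (fun j => (z (Fin.castLE i.isLt j)).1)
      (fun j => (z (Fin.castLE i.isLt.le j)).2) (z i).2) =
    -Real.logb 2 (mixLikelihood ρ p n (fun i => (z i).1) (fun i => (z i).2)) := by
  induction n with
  | zero => simp [mixLikelihood]
  | succ n ih =>
    rw [Fin.sum_univ_castSucc]
    have h := ih (fun i => z i.castSucc)
    have hlast : mixAssignment ρ p n
        (fun j => (z (Fin.castLE (Fin.last n).isLt j)).1)
        (fun j => (z (Fin.castLE (Fin.last n).isLt.le j)).2) (z (Fin.last n)).2 =
        mixLikelihood ρ p (n + 1) (fun i => (z i).1) (fun i => (z i).2) /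
          mixLikelihood ρ p n (fun i => (z i.castSucc).1) (fun i => (z i.castSucc).2) := by
      unfold mixAssignment
      congr 2
      exact Fin.snoc_init_self (α := fun _ => Fin 2) (fun i => (z i).2)
    have h1 := hpos (n + 1) (fun i => (z i).1) (fun i => (z i).2)
    have h2 := hpos n (fun i => (z i.castSucc).1) (fun i => (z i.castSucc).2)
    refine (congrArg₂ (· + ·) h (congrArg (fun t => Real.logb 2 (1 / t)) hlast)).trans ?_
    rw [one_div_div, Real.logb_div h2.ne' h1.ne']
    ring

lemma excessLoss_mixAssignment {S Φ : Type*} [MeasurableSpace Φ] (ρ : Measure Φ)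
    [IsProbabilityMeasure ρ] (p : Φ → S → Fin 2 → ℝ)
    (hpos : ∀ m x y, 0 < mixLikelihood ρ p m x y) (p₀ : S → Fin 2 → ℝ) (n : ℕ)
    (z : Fin n → S × Fin 2) :
    excessLoss (mixAssignment ρ p) p₀ n z = ∑ i, Real.logb 2 (p₀ (z i).1 (z i).2) -
      Real.logb 2 (mixLikelihood ρ p n (fun i => (z i).1) (fun i => (z i).2)) := by
  unfold excessLoss
  rw [sum_logb_one_div_mixAssignment ρ p hpos]
  simp only [one_div, Real.logb_inv, Finset.sum_neg_distrib]
  ring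

/-! ### Likelihoods of halfspace hypotheses and of their mixture. -/

lemma condPmf_nonneg {S : Type*} (g : S → Fin 2) {θ₀ θ₁ : ℝ} (h₀ : θ₀ ∈ Set.Icc (0 : ℝ) 1)
    (h₁ : θ₁ ∈ Set.Icc (0 : ℝ) 1) (x : S) (y : Fin 2) : 0 ≤ condPmf g θ₀ θ₁ x y := by
  obtain ⟨_, _⟩ := h₀
  obtain ⟨_, _⟩ := h₁
  unfold condPmf
  dsimp only
  split_ifs <;> linarith

lemma condPmf_mem_Ioo {S : Type*} (g : S → Fin 2) {θ₀ θ₁ : ℝ} (h₀ : θ₀ ∈ Set.Ioo (0 : ℝ) 1)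
    (h₁ : θ₁ ∈ Set.Ioo (0 : ℝ) 1) (x : S) (y : Fin 2) :
    condPmf g θ₀ θ₁ x y ∈ Set.Ioo (0 : ℝ) 1 := by
  obtain ⟨_, _⟩ := h₀
  obtain ⟨_, _⟩ := h₁
  unfold condPmf
  dsimp only
  split_ifs <;> constructor <;> linarith

lemma condPmf_zero_add_one {S : Type*} (g : S → Fin 2) (θ₀ θ₁ : ℝ) (x : S) :
    condPmf g θ₀ θ₁ x 0 + condPmf g θ₀ θ₁ x 1 = 1 := by
  simp [condPmf]

lemma exists_prod_condPmf_eq {S : Type*} (g : S → Fin 2) (n : ℕ) (x : Fin n → S)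
    (y : Fin n → Fin 2) : ∃ k₀ j₀ k₁ j₁ : ℕ, k₀ + j₀ + (k₁ + j₁) = n ∧ ∀ θ₀ θ₁ : ℝ,
      ∏ i, condPmf g θ₀ θ₁ (x i) (y i) =
        θ₀ ^ k₀ * (1 - θ₀) ^ j₀ * (θ₁ ^ k₁ * (1 - θ₁) ^ j₁) := by
  induction n with
  | zero => exact ⟨0, 0, 0, 0, rfl, fun _ _ => by simp⟩
  | succ n ih =>
    obtain ⟨k₀, j₀, k₁, j₁, hn, h⟩ := ih (fun i => x i.succ) (fun i => y i.succ)
    simp only [Fin.prod_univ_succ, h]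
    by_cases hg : g (x 0) = 0 <;> by_cases hy : y 0 = 1
    · exact ⟨k₀ + 1, j₀, k₁, j₁, by omega, fun _ _ => by simp [condPmf, hg, hy]; ring⟩
    · exact ⟨k₀, j₀ + 1, k₁, j₁, by omega, fun _ _ => by simp [condPmf, hg, hy]; ring⟩
    · exact ⟨k₀, j₀, k₁ + 1, j₁, by omega, fun _ _ => by simp [condPmf, hg, hy]; ring⟩
    · exact ⟨k₀, j₀, k₁, j₁ + 1, by omega, fun _ _ => by simp [condPmf, hg, hy]; ring⟩

/-- By Cauchy–Schwarz the inner product with `x` moves by less than its own size, so its sign is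
kept. -/
lemma halfspace_eq_of_norm_sub_lt {d : ℕ} {a a' x : UnitSphere d}
    (h : ‖(a' : EuclideanSpace ℝ (Fin d)) - a‖ <
      |inner ℝ (a : EuclideanSpace ℝ (Fin d)) (x : EuclideanSpace ℝ (Fin d))|) :
    halfspace a' x = halfspace a x := by
  have hx : ‖(x : EuclideanSpace ℝ (Fin d))‖ = 1 := by simp
  have h1 := abs_real_inner_le_norm ((a' : EuclideanSpace ℝ (Fin d)) - a)
    (x : EuclideanSpace ℝ (Fin d))
  rw [hx, mul_one, inner_sub_left] at h1
  have h2 := abs_le.1 (h1.trans h.le)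
  have h3 := abs_lt.1 (h1.trans_lt h)
  unfold halfspace
  congr 1
  refine propext ⟨fun h' => ?_, fun h' => ?_⟩
  · by_contra hc
    rw [abs_of_neg (not_le.1 hc)] at h3
    linarith [h3.2]
  · rw [abs_of_nonneg h'] at h2
    linarith [h2.1]

lemma measurable_condPmf_halfspace (d : ℕ) :
    Measurable fun w : (UnitSphere d × ℝ × ℝ) × (UnitSphere d × Fin 2) =>
      condPmf (halfspace w.1.1) w.1.2.1 w.1.2.2 w.2.1 w.2.2 := by
  have h1 : Measurable fun w : (UnitSphere d × ℝ × ℝ) × (UnitSphere d × Fin 2) =>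
      halfspace w.1.1 w.2.1 := by
    refine Measurable.ite (measurableSet_le measurable_const ?_) measurable_const measurable_const
    exact Measurable.inner (by fun_prop) (by fun_prop)
  have h2 : Measurable fun w : (UnitSphere d × ℝ × ℝ) × (UnitSphere d × Fin 2) =>
      if halfspace w.1.1 w.2.1 = 0 then w.1.2.1 else w.1.2.2 :=
    Measurable.ite (h1 (measurableSet_singleton 0)) (by fun_prop) (by fun_prop)
  exact Measurable.ite ((measurable_snd.comp measurable_snd) (measurableSet_singleton 1)) h2
    (measurable_const.sub h2)

lemma measurable_prod_condPmf_halfspace (d n : ℕ) (x : Fin n → UnitSphere d) (y : Fin n → Fin 2) :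
    Measurable fun φ : UnitSphere d × ℝ × ℝ =>
      ∏ j, condPmf (halfspace φ.1) φ.2.1 φ.2.2 (x j) (y j) := by
  refine Finset.measurable_prod _ fun j _ => ?_
  exact (measurable_condPmf_halfspace d).comp (measurable_id.prodMk (measurable_const (a := (x j, y j))))

instance : IsProbabilityMeasure (betaMeasure (1 / 2) (1 / 2)) :=
  isProbabilityMeasureBeta (by norm_num) (by norm_num)

lemma isProbabilityMeasure_halfspacePrior {d : ℕ} (hd : 1 ≤ d) :
    IsProbabilityMeasure (halfspacePrior d) := by
  have := isProbabilityMeasure_unifSphere hd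
  unfold halfspacePrior
  infer_instance

lemma ae_halfspacePrior_mem_Ioo {d : ℕ} (hd : 1 ≤ d) :
    ∀ᵐ φ ∂halfspacePrior d, φ.2.1 ∈ Set.Ioo (0 : ℝ) 1 ∧ φ.2.2 ∈ Set.Ioo (0 : ℝ) 1 := by
  have := isProbabilityMeasure_unifSphere hd
  have h := ae_betaMeasure_mem_Ioo (1 / 2) (1 / 2)
  exact Measure.quasiMeasurePreserving_snd.ae
    ((Measure.quasiMeasurePreserving_fst.ae h).and (Measure.quasiMeasurePreserving_snd.ae h))

lemma ae_prod_condPmf_mem_Ioc {d : ℕ} (hd : 1 ≤ d) (n : ℕ) (x : Fin n → UnitSphere d)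
    (y : Fin n → Fin 2) : ∀ᵐ φ ∂halfspacePrior d,
      ∏ j, condPmf (halfspace φ.1) φ.2.1 φ.2.2 (x j) (y j) ∈ Set.Ioc (0 : ℝ) 1 := by
  filter_upwards [ae_halfspacePrior_mem_Ioo hd] with φ hφ
  have h := fun j => condPmf_mem_Ioo (halfspace φ.1) hφ.1 hφ.2 (x j) (y j)
  exact ⟨Finset.prod_pos fun j _ => (h j).1,
    Finset.prod_le_one (fun j _ => (h j).1.le) fun j _ => (h j).2.le⟩

lemma integrable_prod_condPmf {d : ℕ} (hd : 1 ≤ d) (n : ℕ) (x : Fin n → UnitSphere d)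
    (y : Fin n → Fin 2) :
    Integrable (fun φ : UnitSphere d × ℝ × ℝ =>
      ∏ j, condPmf (halfspace φ.1) φ.2.1 φ.2.2 (x j) (y j)) (halfspacePrior d) := by
  have := isProbabilityMeasure_halfspacePrior hd
  refine Integrable.of_bound (measurable_prod_condPmf_halfspace d n x y).aestronglyMeasurable 1 ?_
  filter_upwards [ae_prod_condPmf_mem_Ioc hd n x y] with φ hφ
  rw [Real.norm_of_nonneg hφ.1.le]
  exact hφ.2

/-- The mixture likelihood of the halfspace class. -/
noncomputable abbrev halfspaceLikelihood (d n : ℕ) (x : Fin n → UnitSphere d)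
    (y : Fin n → Fin 2) : ℝ :=
  mixLikelihood (halfspacePrior d) (fun φ => condPmf (halfspace φ.1) φ.2.1 φ.2.2) n x y

lemma halfspaceLikelihood_pos {d : ℕ} (hd : 1 ≤ d) (n : ℕ) (x : Fin n → UnitSphere d)
    (y : Fin n → Fin 2) : 0 < halfspaceLikelihood d n x y := by
  have := isProbabilityMeasure_halfspacePrior hd
  have h := ae_prod_condPmf_mem_Ioc hd n x y
  refine (integral_pos_iff_support_of_nonneg_ae (h.mono fun φ hφ => hφ.1.le)
    (integrable_prod_condPmf hd n x y)).2 ?_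
  rw [pos_iff_ne_zero]
  intro h0
  have h1 : ∀ᵐ φ ∂halfspacePrior d, False := by
    filter_upwards [h, measure_eq_zero_iff_ae_notMem.1 h0] with φ hφ hn
    exact hn hφ.1.ne'
  exact NeZero.ne (halfspacePrior d) (by simpa using h1)

lemma halfspaceLikelihood_le_one {d : ℕ} (hd : 1 ≤ d) (n : ℕ) (x : Fin n → UnitSphere d)
    (y : Fin n → Fin 2) : halfspaceLikelihood d n x y ≤ 1 := by
  have := isProbabilityMeasure_halfspacePrior hd
  refine (integral_mono_ae (integrable_prod_condPmf hd n x y) (integrable_const (1 : ℝ))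
    ((ae_prod_condPmf_mem_Ioc hd n x y).mono fun φ hφ => hφ.2)).trans ?_
  simp

lemma measurable_halfspaceLikelihood {d : ℕ} (hd : 1 ≤ d) (n : ℕ) :
    Measurable fun z : Fin n → UnitSphere d × Fin 2 =>
      halfspaceLikelihood d n (fun i => (z i).1) (fun i => (z i).2) := by
  have := isProbabilityMeasure_halfspacePrior hd
  have h : Measurable fun w : (Fin n → UnitSphere d × Fin 2) × (UnitSphere d × ℝ × ℝ) =>
      ∏ j, condPmf (halfspace w.2.1) w.2.2.1 w.2.2.2 (w.1 j).1 (w.1 j).2 := by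
    refine Finset.measurable_prod _ fun j _ => ?_
    exact (measurable_condPmf_halfspace d).comp
      (measurable_snd.prodMk ((measurable_pi_apply j).comp measurable_fst))
  exact h.stronglyMeasurable.integral_prod_right.measurable

/-! ### Lower bound for the mixture likelihood. -/

/-- On the cap the labelling of the sample is that of `a`, so the integrand separates and the
product prior yields cap mass times two Beta integrals. -/
lemma ofReal_cap_mul_ktProb_le {d : ℕ} (hd : 1 ≤ d) (n : ℕ) (x : Fin n → UnitSphere d)
    (y : Fin n → Fin 2) (a : UnitSphere d) {r : ℝ} (hr0 : 0 < r) (hr1 : r ≤ 1)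
    (hr : ∀ i, r ≤ |inner ℝ (a : EuclideanSpace ℝ (Fin d)) (x i : EuclideanSpace ℝ (Fin d))|)
    {k₀ j₀ k₁ j₁ : ℕ} (h : ∀ θ₀ θ₁ : ℝ, ∏ i, condPmf (halfspace a) θ₀ θ₁ (x i) (y i) =
        θ₀ ^ k₀ * (1 - θ₀) ^ j₀ * (θ₁ ^ k₁ * (1 - θ₁) ^ j₁)) :
    (r / 3) ^ d * (ktProb k₀ j₀ * ktProb k₁ j₁) ≤ halfspaceLikelihood d n x y := by
  have := isProbabilityMeasure_unifSphere hd
  have hk₀ := ktProb_pos k₀ j₀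
  have hk₁ := ktProb_pos k₁ j₁
  set C : Set (UnitSphere d) := {b | ‖(b : EuclideanSpace ℝ (Fin d)) - a‖ < r} with hC
  have hCm : MeasurableSet C := measurableSet_lt (by fun_prop) measurable_const
  have hm : ∀ k j : ℕ, Measurable fun t : ℝ => ENNReal.ofReal (t ^ k * (1 - t) ^ j) :=
    fun k j => by fun_prop
  rw [← ENNReal.ofReal_le_ofReal_iff (halfspaceLikelihood_pos hd n x y).le,
    ENNReal.ofReal_mul (by positivity), ENNReal.ofReal_mul hk₀.le]
  calc ENNReal.ofReal ((r / 3) ^ d) * (ENNReal.ofReal (ktProb k₀ j₀) * ENNReal.ofReal (ktProb k₁ j₁))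
      ≤ (∫⁻ b, C.indicator 1 b ∂unifSphere d) *
          ((∫⁻ t, ENNReal.ofReal (t ^ k₀ * (1 - t) ^ j₀) ∂betaMeasure (1 / 2) (1 / 2)) *
            ∫⁻ t, ENNReal.ofReal (t ^ k₁ * (1 - t) ^ j₁) ∂betaMeasure (1 / 2) (1 / 2)) := by
        rw [lintegral_indicator_one hCm, lintegral_betaMeasure_half, lintegral_betaMeasure_half]
        exact mul_le_mul_left (unifSphere_cap_ge hd a hr0 hr1) _
    _ = ∫⁻ φ, C.indicator 1 φ.1 * (ENNReal.ofReal (φ.2.1 ^ k₀ * (1 - φ.2.1) ^ j₀) *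
          ENNReal.ofReal (φ.2.2 ^ k₁ * (1 - φ.2.2) ^ j₁)) ∂halfspacePrior d := by
        rw [← lintegral_prod_mul (hm _ _).aemeasurable (hm _ _).aemeasurable]
        exact (lintegral_prod_mul (measurable_one.indicator hCm).aemeasurable
          (((hm _ _).comp measurable_fst).mul ((hm _ _).comp measurable_snd)).aemeasurable).symm
    _ ≤ ∫⁻ φ, ENNReal.ofReal (∏ j, condPmf (halfspace φ.1) φ.2.1 φ.2.2 (x j) (y j))
          ∂halfspacePrior d := by
        refine lintegral_mono_ae ?_
        filter_upwards [ae_halfspacePrior_mem_Ioo hd] with φ hφ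
        by_cases hmem : φ.1 ∈ C
        · have e : ∏ j, condPmf (halfspace φ.1) φ.2.1 φ.2.2 (x j) (y j) =
              ∏ j, condPmf (halfspace a) φ.2.1 φ.2.2 (x j) (y j) := by
            refine Finset.prod_congr rfl fun j _ => ?_
            simp only [condPmf, halfspace_eq_of_norm_sub_lt (lt_of_lt_of_le hmem (hr j))]
          have h1 := hφ.1.1
          have h2 : 0 < 1 - φ.2.1 := by linarith [hφ.1.2]
          rw [e, h, Set.indicator_of_mem hmem, Pi.one_apply, one_mul,
            ← ENNReal.ofReal_mul (by positivity)]
        · simp [hmem]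
    _ = _ := by
        exact (ofReal_integral_eq_lintegral_ofReal (integrable_prod_condPmf hd n x y)
          ((ae_prod_condPmf_mem_Ioc hd n x y).mono fun φ hφ => hφ.1.le)).symm

lemma likelihood_mul_le_halfspaceLikelihood {d : ℕ} (hd : 1 ≤ d) (n : ℕ) (x : Fin n → UnitSphere d)
    (y : Fin n → Fin 2) (a : UnitSphere d) {θ₀ θ₁ : ℝ} (h₀ : θ₀ ∈ Set.Icc (0 : ℝ) 1)
    (h₁ : θ₁ ∈ Set.Icc (0 : ℝ) 1) {r : ℝ} (hr0 : 0 < r) (hr1 : r ≤ 1)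
    (hr : ∀ i, r ≤ |inner ℝ (a : EuclideanSpace ℝ (Fin d)) (x i : EuclideanSpace ℝ (Fin d))|) :
    (∏ i, condPmf (halfspace a) θ₀ θ₁ (x i) (y i)) * (r / 3) ^ d ≤
      (2 * (n : ℝ) + 1) * halfspaceLikelihood d n x y := by
  obtain ⟨k₀, j₀, k₁, j₁, hn, h⟩ := exists_prod_condPmf_eq (halfspace a) n x y
  have hlow := ofReal_cap_mul_ktProb_le hd n x y a hr0 hr1 hr h
  have b₀ := bernoulli_likelihood_le_ktProb h₀.1 h₀.2 k₀ j₀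
  have b₁ := bernoulli_likelihood_le_ktProb h₁.1 h₁.2 k₁ j₁
  have hL := factorial_div_halfRising_mul_le (k₀ + j₀) (k₁ + j₁)
  have hk₀ := ktProb_pos k₀ j₀
  have hk₁ := ktProb_pos k₁ j₁
  have hD₀ := halfRising_pos (k₀ + j₀)
  have hD₁ := halfRising_pos (k₁ + j₁)
  have hn' : (((k₀ + j₀ : ℕ) : ℝ) + ((k₁ + j₁ : ℕ) : ℝ)) = n := by exact_mod_cast hn
  rw [hn'] at hL
  have hp : ∏ i, condPmf (halfspace a) θ₀ θ₁ (x i) (y i) ≤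
      (2 * (n : ℝ) + 1) * (ktProb k₀ j₀ * ktProb k₁ j₁) := by
    rw [h]
    have h1 : 0 ≤ 1 - θ₁ := by linarith [h₁.2]
    have h2 := h₁.1
    calc _ ≤ ktProb k₀ j₀ * ((k₀ + j₀).factorial / halfRising (k₀ + j₀)) *
          (ktProb k₁ j₁ * ((k₁ + j₁).factorial / halfRising (k₁ + j₁))) :=
          mul_le_mul b₀ b₁ (by positivity) (by positivity)
      _ = ((k₀ + j₀).factorial / halfRising (k₀ + j₀) *
            ((k₁ + j₁).factorial / halfRising (k₁ + j₁))) * (ktProb k₀ j₀ * ktProb k₁ j₁) := by ring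
      _ ≤ _ := by gcongr
  calc _ ≤ (2 * (n : ℝ) + 1) * (ktProb k₀ j₀ * ktProb k₁ j₁) * (r / 3) ^ d := by gcongr
    _ = (2 * (n : ℝ) + 1) * ((r / 3) ^ d * (ktProb k₀ j₀ * ktProb k₁ j₁)) := by ring
    _ ≤ _ := by gcongr

/-! ### The law of the sample and integrability of the margin moment. -/

lemma lintegral_fst_pairLaw {S : Type*} [MeasurableSpace S] (P : Measure S) [SFinite P]
    {p : S → Fin 2 → ℝ} (hp : Measurable fun z : S × Fin 2 => p z.1 z.2)
    (hp0 : ∀ x y, 0 ≤ p x y) (hp1 : ∀ x, p x 0 + p x 1 = 1) {h : S → ENNReal} (hh : Measurable h) :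
    ∫⁻ z, h z.1 ∂pairLaw P p = ∫⁻ x, h x ∂P := by
  have hh' : Measurable fun z : S × Fin 2 => h z.1 := hh.comp measurable_fst
  rw [pairLaw, lintegral_withDensity_eq_lintegral_mul _ hp.ennreal_ofReal hh',
    lintegral_prod _ (hp.ennreal_ofReal.mul hh').aemeasurable]
  refine lintegral_congr fun x => ?_
  rw [lintegral_count, tsum_fintype, Fin.sum_univ_two]
  simp only [Pi.mul_apply]
  rw [← add_mul, ← ENNReal.ofReal_add (hp0 _ _) (hp0 _ _), hp1, ENNReal.ofReal_one, one_mul]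

lemma measurePreserving_fst_pairLaw {S : Type*} [MeasurableSpace S] (P : Measure S) [SFinite P]
    {p : S → Fin 2 → ℝ} (hp : Measurable fun z : S × Fin 2 => p z.1 z.2)
    (hp0 : ∀ x y, 0 ≤ p x y) (hp1 : ∀ x, p x 0 + p x 1 = 1) :
    MeasurePreserving Prod.fst (pairLaw P p) P := by
  refine ⟨measurable_fst, Measure.ext fun s hs => ?_⟩
  have h := lintegral_fst_pairLaw P hp hp0 hp1 (measurable_one.indicator hs)
  rw [lintegral_indicator_one hs] at h
  rw [Measure.map_apply measurable_fst hs, ← h, ← lintegral_indicator_one (measurable_fst hs)]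
  rfl

lemma ae_pairLaw_pos {S : Type*} [MeasurableSpace S] (P : Measure S)
    {p : S → Fin 2 → ℝ} (hp : Measurable fun z : S × Fin 2 => p z.1 z.2) :
    ∀ᵐ z ∂pairLaw P p, 0 < p z.1 z.2 := by
  rw [pairLaw, ae_withDensity_iff hp.ennreal_ofReal]
  exact Filter.Eventually.of_forall fun z hz => ENNReal.ofReal_pos.1 (pos_iff_ne_zero.2 hz)

lemma integrable_abs_inner_rpow {d : ℕ} (hd : 1 ≤ d) (a : UnitSphere d) :
    Integrable (fun x : UnitSphere d =>
      |inner ℝ (a : EuclideanSpace ℝ (Fin d)) (x : EuclideanSpace ℝ (Fin d))| ^ (-(1 / 2) : ℝ))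
      (unifSphere d) ∧
    ∫ x : UnitSphere d, |inner ℝ (a : EuclideanSpace ℝ (Fin d)) (x : EuclideanSpace ℝ (Fin d))| ^ (-(1 / 2) : ℝ)
      ∂unifSphere d ≤ √(16 * d / 3) ∧
    ∀ᵐ x : UnitSphere d ∂unifSphere d,
      inner ℝ (a : EuclideanSpace ℝ (Fin d)) (x : EuclideanSpace ℝ (Fin d)) ≠ 0 := by
  have hle := lintegral_unifSphere_inner_rpow_le hd a
  have hm : Measurable fun x : UnitSphere d => ENNReal.ofReal
      |inner ℝ (a : EuclideanSpace ℝ (Fin d)) (x : EuclideanSpace ℝ (Fin d))| ^ (-(1 / 2) : ℝ) := by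
    fun_prop
  have hfin := (hle.trans_lt ENNReal.ofReal_lt_top).ne
  have e : (fun x : UnitSphere d =>
      |inner ℝ (a : EuclideanSpace ℝ (Fin d)) (x : EuclideanSpace ℝ (Fin d))| ^ (-(1 / 2) : ℝ)) =
      fun x : UnitSphere d => (ENNReal.ofReal |inner ℝ (a : EuclideanSpace ℝ (Fin d))
        (x : EuclideanSpace ℝ (Fin d))| ^ (-(1 / 2) : ℝ)).toReal := by
    funext x
    rw [← ENNReal.toReal_rpow, ENNReal.toReal_ofReal (abs_nonneg _)]
  have hlt := ae_lt_top hm hfin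
  refine ⟨?_, ?_, ?_⟩
  · rw [e]
    exact integrable_toReal_of_lintegral_ne_top hm.aemeasurable hfin
  · rw [e, integral_toReal hm.aemeasurable hlt]
    exact ENNReal.toReal_le_of_le_ofReal (by positivity) hle
  · filter_upwards [hlt] with x hx h0
    rw [h0] at hx
    simp [ENNReal.zero_rpow_of_neg] at hx

/-! ### Bound on the excess loss and its expectation. -/

/-- Tangent line of the logarithm at `T`. It stands in for Jensen: the linear term has nonpositive
mean once `E S ≤ T`. -/
lemma logb_two_le_add_div {S T : ℝ} (hS : 0 < S) (hT : 0 < T) :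
    Real.logb 2 S ≤ Real.logb 2 T + (S / T - 1) / Real.log 2 := by
  have h := Real.log_le_sub_one_of_pos (div_pos hS hT)
  have h2 : 0 < Real.log 2 := Real.log_pos (by norm_num)
  rw [Real.log_div hS.ne' hT.ne'] at h
  rw [Real.logb, Real.logb, ← add_div]
  gcongr
  linarith

lemma excessLoss_halfspaceMix_eq {d : ℕ} (hd : 1 ≤ d) (p : UnitSphere d → Fin 2 → ℝ) (n : ℕ)
    (z : Fin n → UnitSphere d × Fin 2) :
    excessLoss (halfspaceMix d) p n z = ∑ i, Real.logb 2 (p (z i).1 (z i).2) -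
      Real.logb 2 (halfspaceLikelihood d n (fun i => (z i).1) (fun i => (z i).2)) := by
  have := isProbabilityMeasure_halfspacePrior hd
  exact excessLoss_mixAssignment _ _ (fun m x y => halfspaceLikelihood_pos hd m x y) _ _ _

lemma excessLoss_halfspaceMix_le {d n : ℕ} (hd : 1 ≤ d) (hn : 1 ≤ n) (a : UnitSphere d)
    {θ₀ θ₁ : ℝ} (h₀ : θ₀ ∈ Set.Icc (0 : ℝ) 1) (h₁ : θ₁ ∈ Set.Icc (0 : ℝ) 1)
    (z : Fin n → UnitSphere d × Fin 2)
    (hpos : ∀ i, 0 < condPmf (halfspace a) θ₀ θ₁ (z i).1 (z i).2)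
    (hne : ∀ i, inner ℝ (a : EuclideanSpace ℝ (Fin d)) ((z i).1 : EuclideanSpace ℝ (Fin d)) ≠ 0)
    {T : ℝ} (hT : 0 < T) :
    excessLoss (halfspaceMix d) (condPmf (halfspace a) θ₀ θ₁) n z ≤
      Real.logb 2 (3 * n) + d * Real.logb 2 3 + 2 * d * (Real.logb 2 T +
        ((∑ i, |inner ℝ (a : EuclideanSpace ℝ (Fin d)) ((z i).1 : EuclideanSpace ℝ (Fin d))| ^
          (-(1 / 2) : ℝ)) / T - 1) / Real.log 2) := by
  set S : ℝ := ∑ i, |inner ℝ (a : EuclideanSpace ℝ (Fin d))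
    ((z i).1 : EuclideanSpace ℝ (Fin d))| ^ (-(1 / 2) : ℝ) with hS
  have hn' : (1 : ℝ) ≤ n := by exact_mod_cast hn
  have hterm : ∀ i, |inner ℝ (a : EuclideanSpace ℝ (Fin d))
      ((z i).1 : EuclideanSpace ℝ (Fin d))| ^ (-(1 / 2) : ℝ) ≤ S := fun i =>
    Finset.single_le_sum (f := fun i => |inner ℝ (a : EuclideanSpace ℝ (Fin d))
      ((z i).1 : EuclideanSpace ℝ (Fin d))| ^ (-(1 / 2) : ℝ))
      (fun i _ => by positivity) (Finset.mem_univ i)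
  have habs : ∀ i, |inner ℝ (a : EuclideanSpace ℝ (Fin d))
      ((z i).1 : EuclideanSpace ℝ (Fin d))| ≤ 1 := fun i => by
    refine (abs_real_inner_le_norm _ _).trans ?_
    simp
  have hS1 : 1 ≤ S := by
    refine le_trans ?_ (hterm ⟨0, hn⟩)
    exact Real.one_le_rpow_of_pos_of_le_one_of_nonpos (abs_pos.2 (hne _)) (habs _) (by norm_num)
  have hS0 : 0 < S := by linarith
  have hr : ∀ i, (S ^ 2)⁻¹ ≤ |inner ℝ (a : EuclideanSpace ℝ (Fin d))
      ((z i).1 : EuclideanSpace ℝ (Fin d))| := fun i => by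
    have ht := abs_pos.2 (hne i)
    have h := pow_le_pow_left₀ (by positivity) (hterm i) 2
    rw [← Real.rpow_natCast, ← Real.rpow_mul ht.le,
      show (-(1 / 2) * ((2 : ℕ) : ℝ) : ℝ) = -1 by norm_num, Real.rpow_neg_one] at h
    exact inv_le_of_inv_le₀ ht h
  have hlike := likelihood_mul_le_halfspaceLikelihood hd n (fun i => (z i).1) (fun i => (z i).2) a
    h₀ h₁ (r := (S ^ 2)⁻¹) (by positivity) (inv_le_one_of_one_le₀ (one_le_pow₀ hS1)) hr
  have hm := halfspaceLikelihood_pos hd n (fun i => (z i).1) (fun i => (z i).2)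
  have hp : 0 < ∏ i, condPmf (halfspace a) θ₀ θ₁ (z i).1 (z i).2 :=
    Finset.prod_pos fun i _ => hpos i
  have hlike' : (∏ i, condPmf (halfspace a) θ₀ θ₁ (z i).1 (z i).2) * ((S ^ 2)⁻¹ / 3) ^ d ≤
      (3 * (n : ℝ)) * halfspaceLikelihood d n (fun i => (z i).1) (fun i => (z i).2) :=
    -- `2n + 1 ≤ 3n`, since `n ≥ 1`.
    hlike.trans (by gcongr; linarith)
  have hlog := Real.logb_le_logb_of_le (b := 2) (by norm_num) (by positivity) hlike'
  rw [Real.logb_mul hp.ne' (by positivity), Real.logb_mul (by positivity) hm.ne', Real.logb_pow,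
    Real.logb_div (by positivity) (by norm_num), Real.logb_inv, Real.logb_pow,
    Real.logb_prod _ _ fun i _ => (hpos i).ne'] at hlog
  have hST := mul_le_mul_of_nonneg_left (logb_two_le_add_div hS0 hT)
    (show (0 : ℝ) ≤ 2 * d by positivity)
  rw [excessLoss_halfspaceMix_eq hd]
  push_cast at hlog
  linarith

lemma abs_logb_condPmf_le {S : Type*} (g : S → Fin 2) (θ₀ θ₁ : ℝ) (x : S) (y : Fin 2) :
    |Real.logb 2 (condPmf g θ₀ θ₁ x y)| ≤ |Real.logb 2 θ₀| + |Real.logb 2 (1 - θ₀)| +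
      |Real.logb 2 θ₁| + |Real.logb 2 (1 - θ₁)| := by
  have h1 := abs_nonneg (Real.logb 2 θ₀)
  have h2 := abs_nonneg (Real.logb 2 (1 - θ₀))
  have h3 := abs_nonneg (Real.logb 2 θ₁)
  have h4 := abs_nonneg (Real.logb 2 (1 - θ₁))
  unfold condPmf
  dsimp only
  split_ifs <;> linarith

theorem mainTheorem4 (d n : ℕ) (hd : 1 ≤ d) (hn : 1 ≤ n) :
    (∀ (i : ℕ) (x : Fin (i + 1) → UnitSphere d) (y : Fin i → Fin 2) (b : Fin 2),
      0 < halfspaceMix d i x y b) ∧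
    ∀ (a : UnitSphere d) (θ₀ θ₁ : ℝ), θ₀ ∈ Set.Icc (0 : ℝ) 1 → θ₁ ∈ Set.Icc (0 : ℝ) 1 →
      Integrable (excessLoss (halfspaceMix d) (condPmf (halfspace a) θ₀ θ₁) n)
        (sampleLaw (unifSphere d) (condPmf (halfspace a) θ₀ θ₁) n) ∧
      regret (unifSphere d) (halfspaceMix d) (condPmf (halfspace a) θ₀ θ₁) n ≤
        (2 * (d : ℝ) + 1) * Real.logb 2 n + d * Real.logb 2 (48 * d)
          + Real.logb 2 (Real.pi ^ 2 / 8) := by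
  refine ⟨fun i x y b => div_pos (halfspaceLikelihood_pos hd _ _ _)
    (halfspaceLikelihood_pos hd _ _ _), fun a θ₀ θ₁ h₀ h₁ => ?_⟩
  have := isProbabilityMeasure_unifSphere hd
  set P := unifSphere d
  set p := condPmf (halfspace a) θ₀ θ₁
  have hpm : Measurable fun z : UnitSphere d × Fin 2 => p z.1 z.2 :=
    (measurable_condPmf_halfspace d).comp
      ((measurable_const (a := (a, θ₀, θ₁))).prodMk measurable_id)
  have hfst := measurePreserving_fst_pairLaw P hpm (condPmf_nonneg _ h₀ h₁)
    (condPmf_zero_add_one _ _ _)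
  have : IsProbabilityMeasure (pairLaw P p) := ⟨by
    rw [← Set.preimage_univ (f := Prod.fst), hfst.measure_preimage MeasurableSet.univ.nullMeasurableSet,
      measure_univ]⟩
  have : IsProbabilityMeasure (sampleLaw P p n) := by unfold sampleLaw; infer_instance
  have heval : ∀ i : Fin n, MeasurePreserving (Function.eval i) (sampleLaw P p n) (pairLaw P p) :=
    fun i => measurePreserving_eval (fun _ => pairLaw P p) i
  have hx : ∀ i : Fin n, MeasurePreserving (fun z : Fin n → UnitSphere d × Fin 2 => (z i).1)
      (sampleLaw P p n) P := fun i => hfst.comp (heval i)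
  obtain ⟨hint, hintle, hne⟩ := integrable_abs_inner_rpow hd a
  set φ : UnitSphere d → ℝ := fun x =>
    |inner ℝ (a : EuclideanSpace ℝ (Fin d)) (x : EuclideanSpace ℝ (Fin d))| ^ (-(1 / 2) : ℝ) with hφ
  have hφi : ∀ i : Fin n, Integrable (fun z : Fin n → UnitSphere d × Fin 2 => φ (z i).1)
      (sampleLaw P p n) := fun i => (hx i).integrable_comp_of_integrable hint
  have hφle : ∀ i : Fin n, ∫ z, φ (z i).1 ∂sampleLaw P p n ≤ √(16 * d / 3) := fun i => by
    have hm : AEStronglyMeasurable φ ((sampleLaw P p n).map fun z => (z i).1) := by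
      rw [(hx i).map_eq]
      exact hint.aestronglyMeasurable
    rw [← integral_map (hx i).measurable.aemeasurable hm, (hx i).map_eq]
    exact hintle
  have hSi : Integrable (fun z : Fin n → UnitSphere d × Fin 2 => ∑ i, φ (z i).1)
      (sampleLaw P p n) := integrable_finsetSum _ fun i _ => hφi i
  have hSle : ∫ z, ∑ i, φ (z i).1 ∂sampleLaw P p n ≤ n * √(16 * d / 3) := by
    rw [integral_finsetSum _ fun i _ => hφi i]
    refine (Finset.sum_le_sum fun i _ => hφle i).trans ?_
    simp
  have hd' : (1 : ℝ) ≤ d := by exact_mod_cast hd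
  have hn' : (1 : ℝ) ≤ n := by exact_mod_cast hn
  have hl2 : 0 < Real.log 2 := Real.log_pos (by norm_num)
  set T : ℝ := n * √(16 * d / 3) with hTdef
  have hT : 0 < T := by positivity
  set U : (Fin n → UnitSphere d × Fin 2) → ℝ := fun z =>
    Real.logb 2 (3 * n) + d * Real.logb 2 3 + 2 * d * (Real.logb 2 T +
        ((∑ i, φ (z i).1) / T - 1) / Real.log 2) with hU
  have hUi : Integrable U (sampleLaw P p n) := by
    refine (integrable_const _).add (((integrable_const _).add ?_).const_mul _)
    exact ((hSi.div_const _).sub (integrable_const _)).div_const _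
  have hUint : ∫ z, U z ∂sampleLaw P p n ≤
      Real.logb 2 (3 * n) + d * Real.logb 2 3 + 2 * d * Real.logb 2 T := by
    have h1 : Integrable (fun z => ((∑ i, φ (z i).1) / T - 1) / Real.log 2) (sampleLaw P p n) :=
      ((hSi.div_const _).sub (integrable_const _)).div_const _
    have h1' : Integrable (fun z => Real.logb 2 T + ((∑ i, φ (z i).1) / T - 1) / Real.log 2)
      (sampleLaw P p n) := (integrable_const _).add h1
    have e : ∫ z, U z ∂sampleLaw P p n = Real.logb 2 (3 * n) + d * Real.logb 2 3 +
        2 * d * (Real.logb 2 T +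
          ((∫ z, ∑ i, φ (z i).1 ∂sampleLaw P p n) / T - 1) / Real.log 2) := by
      rw [hU, integral_add (integrable_const _) (h1'.const_mul _),
        integral_const_mul, integral_add (integrable_const _) h1, integral_div,
        integral_sub (hSi.div_const _) (integrable_const _), integral_div]
      simp
    have h2 : ((∫ z, ∑ i, φ (z i).1 ∂sampleLaw P p n) / T - 1) / Real.log 2 ≤ 0 :=
      div_nonpos_of_nonpos_of_nonneg (sub_nonpos.2 ((div_le_one hT).2 hSle)) hl2.le
    rw [e]
    have := mul_nonpos_of_nonneg_of_nonpos (show (0 : ℝ) ≤ 2 * d by positivity) h2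
    linarith
  have hupper : excessLoss (halfspaceMix d) p n ≤ᵐ[sampleLaw P p n] U := by
    have hA : ∀ᵐ z ∂sampleLaw P p n, ∀ i, 0 < p (z i).1 (z i).2 :=
      ae_all_iff.2 fun i => (heval i).quasiMeasurePreserving.ae (ae_pairLaw_pos P hpm)
    have hB : ∀ᵐ z ∂sampleLaw P p n, ∀ i, inner ℝ (a : EuclideanSpace ℝ (Fin d))
        ((z i).1 : EuclideanSpace ℝ (Fin d)) ≠ 0 :=
      ae_all_iff.2 fun i => (hx i).quasiMeasurePreserving.ae hne
    filter_upwards [hA, hB] with z hzA hzB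
    exact excessLoss_halfspaceMix_le hd hn a h₀ h₁ z hzA hzB hT
  have hmeas : Measurable (excessLoss (halfspaceMix d) p n) := by
    rw [funext (excessLoss_halfspaceMix_eq hd p n)]
    refine Measurable.sub (Finset.measurable_sum _ fun i _ => ?_) ?_
    · exact (Real.measurable_log.comp (hpm.comp (measurable_pi_apply i))).div_const _
    · exact (Real.measurable_log.comp (measurable_halfspaceLikelihood hd n)).div_const _
  -- Integrability needs a lower bound too: each `p` value is one of four constants, and the mixture
  -- likelihood is at most 1.
  have hlower : ∀ z, -(∑ _i : Fin n, (|Real.logb 2 θ₀| + |Real.logb 2 (1 - θ₀)| +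
      |Real.logb 2 θ₁| + |Real.logb 2 (1 - θ₁)|)) ≤ excessLoss (halfspaceMix d) p n z := fun z => by
    rw [excessLoss_halfspaceMix_eq hd, ← Finset.sum_neg_distrib]
    have h1 := Finset.sum_le_sum fun (i : Fin n) (_ : i ∈ Finset.univ) =>
      (abs_le.1 (abs_logb_condPmf_le (halfspace a) θ₀ θ₁ (z i).1 (z i).2)).1
    have h2 := Real.logb_nonpos (b := 2) (by norm_num)
      (halfspaceLikelihood_pos hd n (fun i => (z i).1) (fun i => (z i).2)).le
      (halfspaceLikelihood_le_one hd n _ _)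
    linarith
  have hI : Integrable (excessLoss (halfspaceMix d) p n) (sampleLaw P p n) :=
    integrable_of_le_of_le hmeas.aestronglyMeasurable (Filter.Eventually.of_forall hlower) hupper
      (integrable_const _) hUi
  refine ⟨hI, (integral_mono_ae hI hUi hupper).trans (hUint.trans ?_)⟩
  have hs : 2 * Real.logb 2 √(16 * d / 3) = Real.logb 2 (16 * d / 3) := by
    rw [show (2 : ℝ) * Real.logb 2 √(16 * d / 3) = ((2 : ℕ) : ℝ) * Real.logb 2 √(16 * d / 3) by
      norm_num, ← Real.logb_pow, Real.sq_sqrt (by positivity)]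
  have h48 : Real.logb 2 (48 * d) = 2 * Real.logb 2 3 + Real.logb 2 (16 * d / 3) := by
    rw [show (48 : ℝ) * d = 3 * 3 * (16 * d / 3) by ring, Real.logb_mul (by norm_num)
      (by positivity), Real.logb_mul (by norm_num) (by norm_num)]
    ring
  have hpi : 0 ≤ Real.logb 2 (Real.pi ^ 2 / 8) :=
    Real.logb_nonneg (by norm_num) (by nlinarith [Real.pi_gt_three])
  have h3 : 0 ≤ Real.logb 2 3 := Real.logb_nonneg (by norm_num) (by norm_num)
  rw [hTdef, Real.logb_mul (by norm_num) (by positivity : (n : ℝ) ≠ 0),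
    Real.logb_mul (by positivity : (n : ℝ) ≠ 0) (by positivity), h48, ← hs]
  -- What remains is `(d + 1) log 3 ≤ 2d log 3`, true as `d ≥ 1`; the term `log (π²/8)` is only
  -- needed to be nonnegative.
  nlinarith [mul_nonneg (sub_nonneg.2 hd') h3]
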